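/- Let $V\colon L^2[0,1]\to L^2[0,1]$ be the Volterra operator on the complex Hilbert space $L^2[0,1]$, $Vf(x)=\int_0^x f(t)\,dt$, and let $\mu=\alpha+i\beta\in\mathbb{C}\setminus\{0\}$ with $\alpha,\beta\in\mathbb{R}$. Then $V-\mu I$ is invertible, and the operator norm of its inverse is as follows. (i) If $\alpha>\beta^2$, then the equation $\coth\bigl(\frac{\gamma}{\beta^2+\gamma^2}\bigr)=\frac{\alpha}{\gamma}$ has a unique solution $\gamma$ in $(0,\alpha)$, and, for this $\gamma$, \[\|(V-\mu I)^{-1}\|=\frac{1}{\sqrt{\alpha^2-\gamma^2}}.\] (ii) If $\alpha=\beta^2$, then $\|(V-\mu I)^{-1}\|=\frac1\alpha$. (iii) If $\alpha<\beta^2$ and $\beta\neq0$, then there is a unique number $\gamma>0$ such that $\frac{\gamma}{\beta^2-\gamma^2}\in(0,\pi)$ and $\cot\bigl(\frac{\gamma}{\beta^2-\gamma^2}\bigr)=\frac{\alpha}{\gamma}$, and, for this $\gamma$, \[\|(V-\mu I)^{-1}\|=\frac{1}{\sqrt{\alpha^2+\gamma^2}}.\] (iv) If $\alpha<0$ and $\beta=0$,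 then $\|(V-\mu I)^{-1}\|=\frac{1}{|\alpha|}$. -/

import Mathlib

open MeasureTheory Set

noncomputable section

/-- Lebesgue measure on the unit interval `[0,1]`. -/
abbrev unitMeasure : Measure ℝ := volume.restrict (Icc (0 : ℝ) 1)

/-- The complex Hilbert space `L²[0,1]`. -/
abbrev L2unit : Type := Lp ℂ 2 unitMeasure

instance unitMeasure_isProbabilityMeasure : IsProbabilityMeasure unitMeasure :=
  ⟨by simp [unitMeasure]⟩

/-- The function `x ↦ ∫₀ˣ f(t) dt`. -/
def volterraFun (f : ℝ → ℂ) (x : ℝ) : ℂ := ∫ t in (0 : ℝ)..x, f t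

theorem L2unit.integrable (f : L2unit) : Integrable (f : ℝ → ℂ) unitMeasure :=
  (Lp.memLp f).integrable (by norm_num)

theorem L2unit.intervalIntegrable (f : L2unit) {x : ℝ} (hx : x ∈ Icc (0 : ℝ) 1) :
    IntervalIntegrable (f : ℝ → ℂ) volume 0 x := by
  rw [intervalIntegrable_iff_integrableOn_Icc_of_le hx.1]
  exact IntegrableOn.mono_set (t := Icc 0 1) f.integrable (Icc_subset_Icc_right hx.2)

theorem L2unit.integral_norm_le (f : L2unit) : ∫ t, ‖f t‖ ∂unitMeasure ≤ ‖f‖ := by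
  rw [integral_norm_eq_lintegral_enorm f.integrable.aestronglyMeasurable, Lp.norm_def,
    ← eLpNorm_one_eq_lintegral_enorm]
  exact ENNReal.toReal_mono (Lp.eLpNorm_ne_top f)
    (eLpNorm_le_eLpNorm_of_exponent_le (by norm_num) (Lp.aestronglyMeasurable f))

theorem norm_volterraFun_le (f : L2unit) {x : ℝ} (hx : x ∈ Icc (0 : ℝ) 1) :
    ‖volterraFun f x‖ ≤ ‖f‖ := by
  refine le_trans ?_ f.integral_norm_le
  refine (intervalIntegral.norm_integral_le_integral_norm hx.1).trans ?_
  rw [intervalIntegral.integral_of_le hx.1]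
  exact setIntegral_mono_set (s := Ioc 0 x) (t := Icc 0 1) f.integrable.norm
    (Filter.Eventually.of_forall fun _ => norm_nonneg _)
    (Filter.Eventually.of_forall fun t ht => ⟨ht.1.le, ht.2.trans hx.2⟩)

theorem ae_norm_volterraFun_le (f : L2unit) :
    ∀ᵐ x ∂unitMeasure, ‖volterraFun f x‖ ≤ ‖f‖ :=
  (ae_restrict_mem measurableSet_Icc).mono fun _ hx => norm_volterraFun_le f hx

theorem memLp_volterraFun (f : L2unit) : MemLp (volterraFun f) 2 unitMeasure := by
  have hc : ContinuousOn (volterraFun f) (Icc (0 : ℝ) 1) := by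
    have h : IntegrableOn (f : ℝ → ℂ) (uIcc (0 : ℝ) 1) volume := by
      rw [uIcc_of_le zero_le_one]
      exact f.integrable
    have h' := intervalIntegral.continuousOn_primitive_interval h
    rwa [uIcc_of_le zero_le_one] at h'
  exact MemLp.of_bound (hc.aestronglyMeasurable measurableSet_Icc) ‖f‖
    (ae_norm_volterraFun_le f)

/-- The Volterra operator `V : L²[0,1] → L²[0,1]`, `V f (x) = ∫₀ˣ f(t) dt`, as a bounded operator. -/
def volterra : L2unit →L[ℂ] L2unit :=
  LinearMap.mkContinuous
    { toFun := fun f => (memLp_volterraFun f).toLp (volterraFun f)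
      map_add' := fun f g => by
        rw [← MemLp.toLp_add, MemLp.toLp_eq_toLp_iff]
        filter_upwards [ae_restrict_mem measurableSet_Icc] with x hx
        simp only [volterraFun, Pi.add_apply]
        rw [← intervalIntegral.integral_add (f.intervalIntegrable hx) (g.intervalIntegrable hx)]
        have h : ∀ᵐ t ∂volume, t ∈ Icc (0 : ℝ) 1 → (f + g : L2unit) t = f t + g t :=
          (ae_restrict_iff' measurableSet_Icc).1 (Lp.coeFn_add f g)
        refine intervalIntegral.integral_congr_ae (h.mono fun t ht hm => ht ?_)
        rw [uIoc_of_le hx.1] at hm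
        exact ⟨hm.1.le, hm.2.trans hx.2⟩
      map_smul' := fun c f => by
        rw [RingHom.id_apply, ← MemLp.toLp_const_smul, MemLp.toLp_eq_toLp_iff]
        filter_upwards [ae_restrict_mem measurableSet_Icc] with x hx
        simp only [volterraFun, Pi.smul_apply]
        rw [← intervalIntegral.integral_smul]
        have h : ∀ᵐ t ∂volume, t ∈ Icc (0 : ℝ) 1 → (c • f : L2unit) t = c • f t :=
          (ae_restrict_iff' measurableSet_Icc).1 (Lp.coeFn_smul c f)
        refine intervalIntegral.integral_congr_ae (h.mono fun t ht hm => ht ?_)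
        rw [uIoc_of_le hx.1] at hm
        exact ⟨hm.1.le, hm.2.trans hx.2⟩ }
    1 fun f => by
      rw [one_mul]
      have h := Lp.norm_le_of_ae_bound (f := (memLp_volterraFun f).toLp (volterraFun f))
        (norm_nonneg f) (by
          filter_upwards [(memLp_volterraFun f).coeFn_toLp, ae_norm_volterraFun_le f] with x h1 h2
          rwa [h1])
      simpa [measureUnivNNReal] using h

theorem volterra_apply_ae (f : L2unit) :
    ∀ᵐ x ∂unitMeasure, volterra f x = ∫ t in (0 : ℝ)..x, f t :=
  (memLp_volterraFun f).coeFn_toLp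

/-- The real hyperbolic cotangent. -/
def realCoth (x : ℝ) : ℝ := Real.cosh x / Real.sinh x

/-- `(V - μ I)⁻¹`; this is a genuine two-sided inverse exactly when `V - μ I` is a unit. -/
def volterraResolvent (μ : ℂ) : L2unit →L[ℂ] L2unit :=
  Ring.inverse (volterra - μ • (1 : L2unit →L[ℂ] L2unit))

/-- `γ ∈ (0, α)` solves `coth (γ / (β² + γ²)) = α / γ`. -/
def IsCothRoot (α β γ : ℝ) : Prop :=
  γ ∈ Ioo 0 α ∧ realCoth (γ / (β ^ 2 + γ ^ 2)) = α / γ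

/-- `γ > 0`, `γ / (β² - γ²) ∈ (0, π)`, and `cot (γ / (β² - γ²)) = α / γ`. -/
def IsCotRoot (α β γ : ℝ) : Prop :=
  0 < γ ∧ γ / (β ^ 2 - γ ^ 2) ∈ Ioo 0 Real.pi ∧ Real.cot (γ / (β ^ 2 - γ ^ 2)) = α / γ

end

/-! ### The Volterra operator on continuous functions -/

/-! The norm of the inverse is `1/√l` for the largest `l` with `l‖f‖² ≤ ‖(V - μ)f‖²`. On continuous
`f`, which are dense, put `g = Vf`, so that `g' = f` and `g 0 = 0`; the question becomes a calculus
of variations problem for `∫ |g - μg'|² - l|g'|²`. With `c = |μ|² - l`, subtracting the exact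
derivative of `k|g|²` from the integrand leaves `1/c` times a perfect square whenever `k = c u'/u -
α` and `u'' = κu` with `c²κ = c - β²` (Riccati substitution). If `u 0 = 0`, `u > 0` on `(0,1]` and
`c u'(1) = α u(1)`, then `k 1 = 0`, which gives the bound (`IsExtremalProfile.bound`), and a phase
times `u` gives equality (`IsExtremalProfile.exists_extremal`). The sign of `κ` separates the cases:
`u` is `sinh`, the identity or `sin`, and the boundary condition is the coth or cot equation. For `α
< 0`, `β = 0` a constant `k` gives the upper bound, and non-invertibility of `V` the lower one. -/

theorem Continuous.memLp_unitMeasure {f : ℝ → ℂ} (hf : Continuous f) : MemLp f 2 unitMeasure := by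
  obtain ⟨C, hC⟩ := isCompact_Icc.exists_bound_of_continuousOn (s := Icc (0 : ℝ) 1) hf.continuousOn
  exact MemLp.of_bound hf.aestronglyMeasurable C
    ((ae_restrict_mem measurableSet_Icc).mono fun x hx => hC x hx)

/-- The class in `L²[0,1]` of a continuous function. -/
noncomputable def continuousToL2 (f : ℝ → ℂ) (hf : Continuous f) : L2unit :=
  hf.memLp_unitMeasure.toLp f

theorem continuousToL2_ae {f : ℝ → ℂ} (hf : Continuous f) :
    continuousToL2 f hf =ᵐ[unitMeasure] f :=
  hf.memLp_unitMeasure.coeFn_toLp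

theorem norm_continuousToL2_sq {f : ℝ → ℂ} (hf : Continuous f) :
    ‖continuousToL2 f hf‖ ^ 2 = ∫ x in (0 : ℝ)..1, Complex.normSq (f x) := by
  rw [intervalIntegral.integral_of_le zero_le_one, ← integral_Icc_eq_integral_Ioc,
    ← inner_self_eq_norm_sq (𝕜 := ℂ), MeasureTheory.L2.inner_def]
  have h : ∫ x, inner ℂ (continuousToL2 f hf x) (continuousToL2 f hf x) ∂unitMeasure
      = ∫ x, ((Complex.normSq (f x) : ℝ) : ℂ) ∂unitMeasure := by
    refine integral_congr_ae ?_
    filter_upwards [continuousToL2_ae hf] with x hx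
    rw [hx, inner_self_eq_norm_sq_to_K, Complex.normSq_eq_norm_sq]
    push_cast
    rfl
  rw [h, integral_complex_ofReal]
  exact RCLike.ofReal_re (K := ℂ) _

theorem denseRange_continuousToL2 :
    DenseRange fun f : {f : ℝ → ℂ // Continuous f} => continuousToL2 f.1 f.2 := by
  refine (BoundedContinuousFunction.toLp_denseRange ℂ unitMeasure (p := 2) ℂ (by norm_num)).mono ?_
  rintro _ ⟨f, rfl⟩
  refine ⟨⟨f, f.continuous⟩, ?_⟩
  refine Lp.ext ?_
  filter_upwards [continuousToL2_ae f.continuous,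
    BoundedContinuousFunction.coeFn_toLp 2 unitMeasure ℂ f] with x h1 h2
  rw [h1, h2]

theorem hasDerivAt_volterraFun {f : ℝ → ℂ} (hf : Continuous f) (x : ℝ) :
    HasDerivAt (volterraFun f) (f x) x :=
  (hf.integral_hasStrictDerivAt 0 x).hasDerivAt

theorem continuous_volterraFun {f : ℝ → ℂ} (hf : Continuous f) : Continuous (volterraFun f) :=
  continuous_iff_continuousAt.2 fun x => (hasDerivAt_volterraFun hf x).continuousAt

theorem volterraFun_zero (f : ℝ → ℂ) : volterraFun f 0 = 0 :=
  intervalIntegral.integral_same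

theorem volterraFun_congr_ae {f g : ℝ → ℂ} (h : f =ᵐ[unitMeasure] g) {x : ℝ}
    (hx : x ∈ Icc (0 : ℝ) 1) : volterraFun f x = volterraFun g x := by
  have h : ∀ᵐ t ∂volume, t ∈ Icc (0 : ℝ) 1 → f t = g t := (ae_restrict_iff' measurableSet_Icc).1 h
  refine intervalIntegral.integral_congr_ae (h.mono fun t ht hm => ht ?_)
  rw [uIoc_of_le hx.1] at hm
  exact ⟨hm.1.le, hm.2.trans hx.2⟩

/-- The operator `V - μ I`. -/
noncomputable abbrev shiftedVolterra (μ : ℂ) : L2unit →L[ℂ] L2unit :=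
  volterra - μ • (1 : L2unit →L[ℂ] L2unit)

theorem volterra_continuousToL2 {f : ℝ → ℂ} (hf : Continuous f) :
    volterra (continuousToL2 f hf) =
      continuousToL2 (volterraFun f) (continuous_volterraFun hf) := by
  refine Lp.ext ?_
  filter_upwards [volterra_apply_ae (continuousToL2 f hf),
    continuousToL2_ae (continuous_volterraFun hf), ae_restrict_mem measurableSet_Icc] with x h1 h2 hx
  rw [h1, h2]
  exact volterraFun_congr_ae (continuousToL2_ae hf) hx

theorem shiftedVolterra_continuousToL2 (μ : ℂ) {f : ℝ → ℂ} (hf : Continuous f) :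
    shiftedVolterra μ (continuousToL2 f hf) =
      continuousToL2 (fun x => volterraFun f x - μ * f x)
        ((continuous_volterraFun hf).sub (continuous_const.mul hf)) := by
  change volterra (continuousToL2 f hf) - μ • continuousToL2 f hf = _
  rw [volterra_continuousToL2]
  rfl

theorem volterraFun_eq_of_hasDerivAt {f g : ℝ → ℂ} (hf : Continuous f)
    (h : ∀ x, HasDerivAt g (f x) x) (h0 : g 0 = 0) : volterraFun f = g := by
  funext x
  rw [volterraFun, intervalIntegral.integral_eq_sub_of_hasDerivAt (fun y _ => h y)
    (hf.intervalIntegrable _ _), h0, sub_zero]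

/-- Variation of constants: `g - μg' = h` with `g 0 = 0` is solved explicitly, and `f = g'` is the
preimage. This supplies the dense range needed for invertibility. -/
theorem mem_range_shiftedVolterra {μ : ℂ} (hμ : μ ≠ 0) {h : ℝ → ℂ} (hh : Continuous h) :
    continuousToL2 h hh ∈ range (shiftedVolterra μ) := by
  have hc : Continuous fun t : ℝ => Complex.exp (-t / μ) * h t := by fun_prop
  set g : ℝ → ℂ := fun x =>
    -(1 / μ) * (Complex.exp (x / μ) * volterraFun (fun t : ℝ => Complex.exp (-t / μ) * h t) x)
    with hg
  have hd : ∀ x : ℝ, HasDerivAt g ((g x - h x) / μ) x := by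
    intro x
    have h1 : HasDerivAt (fun y : ℝ => Complex.exp ((y : ℂ) / μ))
        (Complex.exp ((x : ℂ) / μ) * (1 / μ)) x :=
      ((Complex.ofRealCLM.hasDerivAt (x := x)).div_const μ).cexp
    refine HasDerivAt.congr_deriv ((h1.mul (hasDerivAt_volterraFun hc x)).const_mul (-(1 / μ))) ?_
    have h2 : Complex.exp ((x : ℂ) / μ) * (Complex.exp (-(x : ℂ) / μ) * h x) = h x := by
      rw [← mul_assoc, ← Complex.exp_add, neg_div, add_neg_cancel, Complex.exp_zero, one_mul]
    rw [h2, hg]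
    field_simp
    ring
  have hgc : Continuous g := continuous_iff_continuousAt.2 fun x => (hd x).continuousAt
  have hfc : Continuous fun x => (g x - h x) / μ := (hgc.sub hh).div_const μ
  refine ⟨continuousToL2 _ hfc, ?_⟩
  rw [shiftedVolterra_continuousToL2]
  congr 1
  rw [volterraFun_eq_of_hasDerivAt hfc hd (by simp [hg, volterraFun_zero])]
  funext x
  field_simp
  ring

/-! ### Invertibility and the norm of the inverse -/

/-- An operator bounded below is injective with closed range; here the range is also dense, hence
everything. -/
theorem isUnit_shiftedVolterra_of_bound {μ : ℂ} (hμ : μ ≠ 0) {l : ℝ} (hl : 0 < l)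
    (hb : ∀ f : L2unit, l * ‖f‖ ^ 2 ≤ ‖shiftedVolterra μ f‖ ^ 2) :
    IsUnit (shiftedVolterra μ) := by
  have ha : AntilipschitzWith (Real.toNNReal (1 / √l)) (shiftedVolterra μ) := by
    refine ContinuousLinearMap.antilipschitz_of_bound _ fun f => ?_
    have hs : 0 < √l := Real.sqrt_pos.2 hl
    rw [Real.coe_toNNReal _ (by positivity), one_div, ← div_eq_inv_mul, le_div_iff₀ hs]
    refine le_of_sq_le_sq ?_ (norm_nonneg _)
    rw [mul_pow, Real.sq_sqrt hl.le, mul_comm]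
    exact hb f
  refine ContinuousLinearMap.isUnit_iff_bijective.2 ⟨ha.injective, ?_⟩
  rw [← range_eq_univ, ← (ha.isClosed_range (shiftedVolterra μ).uniformContinuous).closure_eq]
  refine Dense.closure_eq (denseRange_continuousToL2.mono ?_)
  rintro _ ⟨f, rfl⟩
  exact mem_range_shiftedVolterra hμ f.2

theorem norm_volterraResolvent_le {μ : ℂ} {l : ℝ} (hl : 0 < l) (hu : IsUnit (shiftedVolterra μ))
    (hb : ∀ f : L2unit, l * ‖f‖ ^ 2 ≤ ‖shiftedVolterra μ f‖ ^ 2) :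
    ‖volterraResolvent μ‖ ≤ 1 / √l := by
  have hs : 0 < √l := Real.sqrt_pos.2 hl
  refine ContinuousLinearMap.opNorm_le_bound _ (by positivity) fun f => ?_
  have h1 : shiftedVolterra μ (volterraResolvent μ f) = f :=
    DFunLike.congr_fun (Ring.mul_inverse_cancel _ hu) f
  have h2 := hb (volterraResolvent μ f)
  rw [h1] at h2
  rw [one_div, ← div_eq_inv_mul, le_div_iff₀ hs]
  refine le_of_sq_le_sq ?_ (norm_nonneg _)
  rwa [mul_pow, Real.sq_sqrt hl.le, mul_comm]

theorem le_norm_volterraResolvent {μ : ℂ} {l : ℝ} (hl : 0 < l) (hu : IsUnit (shiftedVolterra μ))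
    {f : L2unit} (hf : f ≠ 0) (he : ‖shiftedVolterra μ f‖ ^ 2 = l * ‖f‖ ^ 2) :
    1 / √l ≤ ‖volterraResolvent μ‖ := by
  have hs : 0 < √l := Real.sqrt_pos.2 hl
  have h1 : volterraResolvent μ (shiftedVolterra μ f) = f :=
    DFunLike.congr_fun (Ring.inverse_mul_cancel _ hu) f
  have h2 := (volterraResolvent μ).le_opNorm (shiftedVolterra μ f)
  have h3 : ‖shiftedVolterra μ f‖ = √l * ‖f‖ := by
    rw [← Real.sqrt_sq (norm_nonneg (shiftedVolterra μ f)), he, Real.sqrt_mul hl.le,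
      Real.sqrt_sq (norm_nonneg f)]
  rw [h1, h3, ← mul_assoc] at h2
  rw [div_le_iff₀ hs]
  exact le_of_mul_le_mul_right (by rwa [one_mul]) (norm_pos_iff.2 hf)

/-- Everything in the range has a continuous representative vanishing at `0`, so the constant `1` is
not attained. -/
theorem not_isUnit_volterra : ¬ IsUnit volterra := by
  intro hu
  obtain ⟨f, hf⟩ := (ContinuousLinearMap.isUnit_iff_bijective.1 hu).2
    (continuousToL2 (fun _ => 1) continuous_const)
  have h1 : ∀ᵐ x ∂unitMeasure, volterraFun f x = 1 := by
    filter_upwards [volterra_apply_ae f, continuousToL2_ae (f := fun _ => 1) continuous_const]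
      with x h1 h2
    rw [volterraFun, ← h1, hf, h2]
  have hc : ContinuousOn (volterraFun f) (Icc (0 : ℝ) 1) := by
    have h : IntegrableOn (f : ℝ → ℂ) (uIcc (0 : ℝ) 1) volume := by
      rw [uIcc_of_le zero_le_one]
      exact f.integrable
    have h' := intervalIntegral.continuousOn_primitive_interval h
    rwa [uIcc_of_le zero_le_one] at h'
  have h2 := Measure.eqOn_Icc_of_ae_eq volume zero_ne_one h1 hc continuousOn_const
  have h3 := h2 (left_mem_Icc.2 zero_le_one)
  rw [volterraFun_zero] at h3
  exact zero_ne_one h3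

/-- `V` lies within `‖μ‖` of `V - μ`, because `‖V‖ ≤ 1`... only through `‖μ I‖ ≤ ‖μ‖`: a smaller
inverse would put `V` in the ball of units around `V - μ`. -/
theorem inv_norm_le_norm_volterraResolvent {μ : ℂ} (hu : IsUnit (shiftedVolterra μ)) :
    1 / ‖μ‖ ≤ ‖volterraResolvent μ‖ := by
  by_contra! hlt
  obtain ⟨u, hu'⟩ := hu
  have hr : volterraResolvent μ = ↑u⁻¹ := by
    change Ring.inverse (shiftedVolterra μ) = _
    rw [← hu', Ring.inverse_unit]
  rw [hr] at hlt
  -- For `μ = 0` the left side is `1 / 0 = 0`, which no norm can be below.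
  have hμ : 0 < ‖μ‖ := by
    by_contra! h
    rw [le_antisymm h (norm_nonneg _), div_zero] at hlt
    exact absurd hlt (not_lt.2 (norm_nonneg _))
  have hpos : 0 < ‖(↑u⁻¹ : L2unit →L[ℂ] L2unit)‖ := by
    have : Nontrivial (L2unit →L[ℂ] L2unit) := by
      refine ⟨⟨volterra, 1, fun h => not_isUnit_volterra (h ▸ isUnit_one)⟩⟩
    exact Units.norm_pos _
  refine not_isUnit_volterra ⟨Units.ofNearby u volterra ?_, rfl⟩
  have h4 : ‖volterra - (u : L2unit →L[ℂ] L2unit)‖ ≤ ‖μ‖ := by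
    rw [hu', shiftedVolterra, sub_sub_cancel, norm_smul]
    exact mul_le_of_le_one_right (norm_nonneg _) ContinuousLinearMap.norm_id_le
  refine h4.trans_lt ?_
  rwa [lt_inv_comm₀ hμ hpos, ← one_div ‖μ‖]

/-! ### The quadratic form of the shifted operator -/

theorem hasDerivAt_normSq {g : ℝ → ℂ} {z : ℂ} {x : ℝ} (h : HasDerivAt g z x) :
    HasDerivAt (fun y => Complex.normSq (g y)) (2 * ((g x).re * z.re + (g x).im * z.im)) x := by
  have hr : HasDerivAt (fun y => (g y).re) z.re x :=
    (Complex.reCLM.hasFDerivAt.comp_hasDerivAt x h)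
  have hi : HasDerivAt (fun y => (g y).im) z.im x :=
    (Complex.imCLM.hasFDerivAt.comp_hasDerivAt x h)
  simp only [Complex.normSq_apply]
  refine HasDerivAt.congr_deriv ((hr.mul hr).add (hi.mul hi)) ?_
  ring

theorem continuous_normSq_sub {μ : ℂ} {f g : ℝ → ℂ} (hf : Continuous f) (hg : Continuous g) :
    Continuous fun x => Complex.normSq (g x - μ * f x) :=
  Complex.continuous_normSq.comp (hg.sub (continuous_const.mul hf))

theorem norm_shiftedVolterra_sq_sub (μ : ℂ) (l : ℝ) {f : ℝ → ℂ} (hf : Continuous f) :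
    ‖shiftedVolterra μ (continuousToL2 f hf)‖ ^ 2 - l * ‖continuousToL2 f hf‖ ^ 2 =
      ∫ x in (0 : ℝ)..1,
        (Complex.normSq (volterraFun f x - μ * f x) - l * Complex.normSq (f x)) := by
  rw [shiftedVolterra_continuousToL2, norm_continuousToL2_sq, norm_continuousToL2_sq,
    intervalIntegral.integral_sub, intervalIntegral.integral_const_mul]
  · exact (continuous_normSq_sub hf (continuous_volterraFun hf)).intervalIntegrable _ _
  · exact (continuous_const.mul (Complex.continuous_normSq.comp hf)).intervalIntegrable _ _

/-- A differential inequality for `k` bounds the quadratic form from below by a boundary term. -/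
theorem boundary_le_quadraticForm {μ : ℂ} {l : ℝ} {k k' : ℝ → ℝ}
    (hk : ∀ x ∈ Icc (0 : ℝ) 1, HasDerivAt k (k' x) x)
    (hq : ∀ x ∈ Icc (0 : ℝ) 1, ∀ z y : ℂ,
      k' x * Complex.normSq z + k x * (2 * (z.re * y.re + z.im * y.im)) ≤
        Complex.normSq (z - μ * y) - l * Complex.normSq y)
    {f : ℝ → ℂ} (hf : Continuous f) :
    k 1 * Complex.normSq (volterraFun f 1) ≤
      ‖shiftedVolterra μ (continuousToL2 f hf)‖ ^ 2 - l * ‖continuousToL2 f hf‖ ^ 2 := by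
  rw [norm_shiftedVolterra_sq_sub]
  have hd : ∀ x ∈ Icc (0 : ℝ) 1,
      HasDerivAt (fun y => k y * Complex.normSq (volterraFun f y)) _ x := fun x hx =>
    (hk x hx).mul (hasDerivAt_normSq (hasDerivAt_volterraFun hf x))
  have h := intervalIntegral.sub_le_integral_of_hasDeriv_right_of_le zero_le_one
    (fun x hx => (hd x hx).continuousAt.continuousWithinAt)
    (fun x hx => (hd x (Ioo_subset_Icc_self hx)).hasDerivWithinAt)
    (φ := fun x => Complex.normSq (volterraFun f x - μ * f x) - l * Complex.normSq (f x))
    (((continuous_normSq_sub hf (continuous_volterraFun hf)).sub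
      (continuous_const.mul (Complex.continuous_normSq.comp hf))).integrableOn_Icc)
    (fun x hx => hq x (Ioo_subset_Icc_self hx) _ _)
  -- The boundary term at `0` vanishes whatever the value of `k 0`.
  rwa [volterraFun_zero, map_zero, mul_zero, sub_zero] at h

/-- The ideal multiplier, with `k 1 = 0`, may have a pole at `0`. Regular multipliers with `k 1 ≥
-δ` suffice, since `δ` tends to `0` for each fixed continuous `f` before density is used. -/
theorem bound_of_approximate_multipliers {μ : ℂ} {l : ℝ}
    (h : ∀ δ > 0, ∃ k k' : ℝ → ℝ, (∀ x ∈ Icc (0 : ℝ) 1, HasDerivAt k (k' x) x) ∧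
      (∀ x ∈ Icc (0 : ℝ) 1, ∀ z y : ℂ,
        k' x * Complex.normSq z + k x * (2 * (z.re * y.re + z.im * y.im)) ≤
          Complex.normSq (z - μ * y) - l * Complex.normSq y) ∧ -δ ≤ k 1) (f : L2unit) :
    l * ‖f‖ ^ 2 ≤ ‖shiftedVolterra μ f‖ ^ 2 := by
  refine denseRange_continuousToL2.induction_on
    (p := fun f => l * ‖f‖ ^ 2 ≤ ‖shiftedVolterra μ f‖ ^ 2) f ?_ ?_
  · exact isClosed_le (by fun_prop) (by fun_prop)
  rintro ⟨f, hf⟩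
  set N := Complex.normSq (volterraFun f 1)
  have hN : 0 ≤ N := Complex.normSq_nonneg _
  refine le_of_forall_pos_le_add fun e he => ?_
  obtain ⟨k, k', hk, hq, h1⟩ := h (e / (N + 1)) (by positivity)
  have h2 := boundary_le_quadraticForm hk hq hf
  have h3 : -(e / (N + 1)) * N ≤ k 1 * N := mul_le_mul_of_nonneg_right h1 hN
  have h4 : e / (N + 1) * N ≤ e := by
    rw [div_mul_eq_mul_div, div_le_iff₀ (by positivity)]
    nlinarith
  change _ * ‖continuousToL2 f hf‖ ^ 2 ≤ ‖shiftedVolterra μ (continuousToL2 f hf)‖ ^ 2 + e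
  linarith

/-- `u` solves `u'' = κ u`, `u 0 = 0`, is positive on `(0,1]`, and `c u'(1) = α u(1)`. -/
structure IsExtremalProfile (α c κ : ℝ) (u u' : ℝ → ℝ) : Prop where
  deriv : ∀ x, HasDerivAt u (u' x) x
  deriv' : ∀ x, HasDerivAt u' (κ * u x) x
  zero : u 0 = 0
  pos : ∀ x ∈ Ioc (0 : ℝ) 1, 0 < u x
  boundary : c * u' 1 = α * u 1

/-! ### Sharp bound and extremal function from a profile -/

namespace IsExtremalProfile

variable {α β c κ : ℝ} {u u' : ℝ → ℝ}

/-- Shifting `u` to the left moves its zero out of `[0,1]`, which makes `u'/u` regular there;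
continuity at `1` covers the overshoot. -/
theorem exists_pos_translates (h : IsExtremalProfile α c κ u u') :
    ∀ᶠ e in nhdsWithin (0 : ℝ) (Ioi 0), ∀ x ∈ Icc (0 : ℝ) 1, 0 < u (x + e) := by
  have hc : ContinuousAt u 1 := (h.deriv 1).continuousAt
  have h1 : ∀ᶠ y in nhds (1 : ℝ), 0 < u y :=
    hc.eventually (lt_mem_nhds (h.pos 1 (right_mem_Ioc.2 zero_lt_one)))
  obtain ⟨d, hd, h2⟩ := Metric.eventually_nhds_iff.1 h1
  filter_upwards [Ioo_mem_nhdsGT hd] with e he x hx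
  rcases le_or_gt (x + e) 1 with h3 | h3
  · exact h.pos _ ⟨by linarith [hx.1, he.1], h3⟩
  · refine h2 ?_
    rw [Real.dist_eq, abs_lt]
    constructor <;> linarith [hx.2, he.2]

theorem bound (h : IsExtremalProfile α c κ u u') (hc : 0 < c) (hκ : c ^ 2 * κ = c - β ^ 2)
    (f : L2unit) :
    (α ^ 2 + β ^ 2 - c) * ‖f‖ ^ 2 ≤
      ‖shiftedVolterra ((α : ℂ) + (β : ℂ) * Complex.I) f‖ ^ 2 := by
  refine bound_of_approximate_multipliers (fun δ hδ => ?_) f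
  have h1 : 0 < u 1 := h.pos 1 (right_mem_Ioc.2 zero_lt_one)
  have hlim : ContinuousAt (fun e => c * (u' (1 + e) / u (1 + e)) - α) 0 := by
    have ha : ContinuousAt u (1 + 0) := (h.deriv _).continuousAt
    have hb : ContinuousAt u' (1 + 0) := (h.deriv' _).continuousAt
    have hadd : ContinuousAt (fun e : ℝ => 1 + e) 0 := by fun_prop
    refine (continuousAt_const.mul (ContinuousAt.div (hb.comp' hadd) (ha.comp' hadd) ?_)).sub
      continuousAt_const
    simpa using h1.ne'
  have h0 : c * (u' (1 + 0) / u (1 + 0)) - α = 0 := by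
    rw [add_zero, ← mul_div_assoc, h.boundary, mul_div_assoc, div_self h1.ne', mul_one, sub_self]
  have hev : ∀ᶠ e in nhdsWithin (0 : ℝ) (Ioi 0), -δ < c * (u' (1 + e) / u (1 + e)) - α := by
    refine (hlim.eventually (lt_mem_nhds ?_)).filter_mono nhdsWithin_le_nhds
    change -δ < c * (u' (1 + 0) / u (1 + 0)) - α
    rw [h0]
    linarith
  obtain ⟨e, hpos, he⟩ := (h.exists_pos_translates.and hev).exists
  refine ⟨fun x => c * (u' (x + e) / u (x + e)) - α,
    fun x => c * (κ - (u' (x + e) / u (x + e)) ^ 2), fun x hx => ?_, fun x hx z y => ?_, he.le⟩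
  · have hx' := (hpos x hx).ne'
    refine HasDerivAt.congr_deriv (((((h.deriv' (x + e)).comp_add_const x e).div
      ((h.deriv (x + e)).comp_add_const x e) hx').const_mul c).sub_const α) ?_
    field_simp
  · set w := u' (x + e) / u (x + e)
    have hsq : 0 ≤ Complex.normSq ((c : ℂ) * y + (β * Complex.I - c * w) * z) :=
      Complex.normSq_nonneg _
    -- Completing the square in `y`; the relation `hκ` is exactly what matches the coefficients of
    -- `|z|²`.
    have hkey : Complex.normSq ((c : ℂ) * y + (β * Complex.I - c * w) * z) =
        c * (Complex.normSq (z - (α + β * Complex.I) * y)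
          - (α ^ 2 + β ^ 2 - c) * Complex.normSq y
          - (c * (κ - w ^ 2) * Complex.normSq z
            + (c * w - α) * (2 * (z.re * y.re + z.im * y.im)))) := by
      simp only [Complex.normSq_apply, Complex.add_re, Complex.add_im, Complex.sub_re,
        Complex.sub_im, Complex.mul_re, Complex.mul_im, Complex.ofReal_re, Complex.ofReal_im,
        Complex.I_re, Complex.I_im]
      linear_combination (z.re ^ 2 + z.im ^ 2) * hκ
    rw [hkey] at hsq
    have := nonneg_of_mul_nonneg_right hsq hc
    linarith

theorem exists_extremal (h : IsExtremalProfile α c κ u u') (hc : 0 < c)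
    (hκ : c ^ 2 * κ = c - β ^ 2) :
    ∃ f : L2unit, f ≠ 0 ∧ ‖shiftedVolterra ((α : ℂ) + (β : ℂ) * Complex.I) f‖ ^ 2 =
      (α ^ 2 + β ^ 2 - c) * ‖f‖ ^ 2 := by
  have h1 : 0 < u 1 := h.pos 1 (right_mem_Ioc.2 zero_lt_one)
  have huc : Continuous u := continuous_iff_continuousAt.2 fun x => (h.deriv x).continuousAt
  have huc' : Continuous u' := continuous_iff_continuousAt.2 fun x => (h.deriv' x).continuousAt
  -- Equality requires the square in `bound` to vanish without the shift: `g'/g = u'/u - iβ/c`, so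
  -- `g = exp(-iβx/c) u`.
  set b : ℝ := -(β / c) with hb
  set E : ℝ → ℂ := fun x => Complex.exp ((b * x : ℝ) * Complex.I) with hE
  set g : ℝ → ℂ := fun x => E x * u x with hg
  set f : ℝ → ℂ := fun x => E x * (u' x + b * u x * Complex.I) with hf
  have hfc : Continuous f := by fun_prop
  have hd : ∀ x, HasDerivAt g (f x) x := by
    intro x
    have hbx : HasDerivAt (fun y : ℝ => b * y) b x := by
      simpa using (hasDerivAt_id x).const_mul b
    have h2 : HasDerivAt E (E x * (b * Complex.I)) x :=
      (hbx.ofReal_comp.mul_const Complex.I).cexp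
    refine HasDerivAt.congr_deriv (h2.mul (h.deriv x).ofReal_comp) ?_
    simp only [hf]
    ring
  have hV : volterraFun f = g := volterraFun_eq_of_hasDerivAt hfc hd (by simp [hg, h.zero])
  have hnE : ∀ x, Complex.normSq (E x) = 1 := fun x => by
    rw [Complex.normSq_eq_norm_sq, hE, Complex.norm_exp_ofReal_mul_I, one_pow]
  refine ⟨continuousToL2 f hfc, fun h0 => ?_, ?_⟩
  · have h2 : f =ᵐ[unitMeasure] fun _ => 0 := by
      refine (continuousToL2_ae hfc).symm.trans ?_
      rw [h0]
      exact Lp.coeFn_zero _ _ _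
    have h3 := volterraFun_congr_ae h2 (right_mem_Icc.2 zero_le_one)
    rw [hV] at h3
    have h4 : Complex.normSq (g 1) = 0 := by
      rw [h3]
      simp [volterraFun]
    rw [hg, map_mul, hnE, one_mul, Complex.normSq_ofReal] at h4
    exact (mul_pos h1 h1).ne' h4
  · rw [← sub_eq_zero, norm_shiftedVolterra_sq_sub, hV]
    -- For this `g` the integrand is the derivative of `c u u' - α u²`, which vanishes at `0` by `u
    -- 0 = 0` and at `1` by the boundary condition.
    have hF : ∀ x, HasDerivAt (fun y => c * (u y * u' y) - α * (u y * u y))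
        (c * (u' x * u' x + u x * (κ * u x)) - α * (u' x * u x + u x * u' x)) x := fun x =>
      (((h.deriv x).mul (h.deriv' x)).const_mul c).sub
        (((h.deriv x).mul (h.deriv x)).const_mul α)
    have hbc : c * b = -β := by
      rw [hb]
      field_simp
    have hκ' : c * κ = 1 - c * b ^ 2 := by
      refine mul_left_cancel₀ hc.ne' ?_
      linear_combination hκ + (c * b - β) * hbc
    have hpt : ∀ x, Complex.normSq (g x - (α + β * Complex.I) * f x)
        - (α ^ 2 + β ^ 2 - c) * Complex.normSq (f x) =
        c * (u' x * u' x + u x * (κ * u x)) - α * (u' x * u x + u x * u' x) := by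
      intro x
      have h5 : g x - (α + β * Complex.I) * f x =
          E x * (u x - (α + β * Complex.I) * (u' x + b * u x * Complex.I)) := by
        simp only [hg, hf]
        ring
      rw [h5, hf, map_mul, map_mul, hnE, one_mul, one_mul]
      simp only [Complex.normSq_apply, Complex.add_re, Complex.add_im, Complex.sub_re,
        Complex.sub_im, Complex.mul_re, Complex.mul_im, Complex.ofReal_re, Complex.ofReal_im,
        Complex.I_re, Complex.I_im]
      linear_combination (-(u x) ^ 2) * hκ' + 2 * b * (u x) ^ 2 * hbc
    simp only [hpt]
    rw [intervalIntegral.integral_eq_sub_of_hasDerivAt (fun x _ => hF x)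
      (Continuous.intervalIntegrable (by fun_prop) _ _), h.zero]
    linear_combination u 1 * h.boundary

theorem isUnit_and_norm (h : IsExtremalProfile α c κ u u') (hc : 0 < c)
    (hκ : c ^ 2 * κ = c - β ^ 2) (hl : 0 < α ^ 2 + β ^ 2 - c) :
    IsUnit (shiftedVolterra ((α : ℂ) + (β : ℂ) * Complex.I)) ∧
      ‖volterraResolvent ((α : ℂ) + (β : ℂ) * Complex.I)‖ = 1 / √(α ^ 2 + β ^ 2 - c) := by
  have hμ : (α : ℂ) + (β : ℂ) * Complex.I ≠ 0 := by
    intro h0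
    have hr := congrArg Complex.re h0
    have hi := congrArg Complex.im h0
    simp at hr hi
    rw [hr, hi] at hl
    linarith
  have hu := isUnit_shiftedVolterra_of_bound hμ hl (h.bound hc hκ)
  obtain ⟨f, hf, he⟩ := h.exists_extremal hc hκ
  exact ⟨hu, le_antisymm (norm_volterraResolvent_le hl hu (h.bound hc hκ))
    (le_norm_volterraResolvent hl hu hf he)⟩

end IsExtremalProfile

/-! ### The four cases -/

theorem IsCothRoot.isUnit_and_norm {α β γ : ℝ} (h : IsCothRoot α β γ) :
    IsUnit (shiftedVolterra ((α : ℂ) + (β : ℂ) * Complex.I)) ∧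
      ‖volterraResolvent ((α : ℂ) + (β : ℂ) * Complex.I)‖ = 1 / √(α ^ 2 - γ ^ 2) := by
  obtain ⟨⟨h0, h1⟩, h2⟩ := h
  set c := β ^ 2 + γ ^ 2 with hcdef
  have hc : 0 < c := by positivity
  have hs : 0 < Real.sinh (γ / c) := Real.sinh_pos_iff.2 (by positivity)
  have hlin : ∀ x, HasDerivAt (fun y : ℝ => γ / c * y) (γ / c) x := fun x => by
    simpa using (hasDerivAt_id x).const_mul (γ / c)
  have hp : IsExtremalProfile α c ((γ / c) ^ 2) (fun x => Real.sinh (γ / c * x))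
      (fun x => γ / c * Real.cosh (γ / c * x)) := by
    refine ⟨fun x => ?_, fun x => ?_, by simp, fun x hx => ?_, ?_⟩
    · refine HasDerivAt.congr_deriv ((hlin x).sinh) ?_
      ring
    · refine HasDerivAt.congr_deriv ((hlin x).cosh.const_mul (γ / c)) ?_
      ring
    · exact Real.sinh_pos_iff.2 (mul_pos (by positivity) hx.1)
    · rw [realCoth, div_eq_div_iff hs.ne' h0.ne'] at h2
      simp only [mul_one]
      rw [← mul_assoc, mul_div_cancel₀ _ hc.ne']
      linarith
  have he : α ^ 2 + β ^ 2 - c = α ^ 2 - γ ^ 2 := by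
    rw [hcdef]
    ring
  rw [← he]
  refine hp.isUnit_and_norm hc ?_ ?_
  · rw [← mul_pow, mul_div_cancel₀ _ hc.ne', hcdef]
    ring
  · rw [he]
    nlinarith

theorem IsCotRoot.isUnit_and_norm {α β γ : ℝ} (h : IsCotRoot α β γ) :
    IsUnit (shiftedVolterra ((α : ℂ) + (β : ℂ) * Complex.I)) ∧
      ‖volterraResolvent ((α : ℂ) + (β : ℂ) * Complex.I)‖ = 1 / √(α ^ 2 + γ ^ 2) := by
  obtain ⟨h0, ⟨h1, h1'⟩, h2⟩ := h
  set c := β ^ 2 - γ ^ 2 with hcdef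
  have hc : 0 < c := (div_pos_iff_of_pos_left h0).1 h1
  have hs : 0 < Real.sin (γ / c) := Real.sin_pos_of_pos_of_lt_pi h1 h1'
  have hlin : ∀ x, HasDerivAt (fun y : ℝ => γ / c * y) (γ / c) x := fun x => by
    simpa using (hasDerivAt_id x).const_mul (γ / c)
  have hp : IsExtremalProfile α c (-(γ / c) ^ 2) (fun x => Real.sin (γ / c * x))
      (fun x => γ / c * Real.cos (γ / c * x)) := by
    refine ⟨fun x => ?_, fun x => ?_, by simp, fun x hx => ?_, ?_⟩
    · refine HasDerivAt.congr_deriv ((hlin x).sin) ?_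
      ring
    · refine HasDerivAt.congr_deriv ((hlin x).cos.const_mul (γ / c)) ?_
      ring
    · exact Real.sin_pos_of_pos_of_lt_pi (mul_pos h1 hx.1)
        ((mul_le_of_le_one_right h1.le hx.2).trans_lt h1')
    · rw [Real.cot_eq_cos_div_sin, div_eq_div_iff hs.ne' h0.ne'] at h2
      simp only [mul_one]
      rw [← mul_assoc, mul_div_cancel₀ _ hc.ne']
      linarith
  have he : α ^ 2 + β ^ 2 - c = α ^ 2 + γ ^ 2 := by
    rw [hcdef]
    ring
  rw [← he]
  refine hp.isUnit_and_norm hc ?_ ?_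
  · rw [mul_neg, ← mul_pow, mul_div_cancel₀ _ hc.ne', hcdef]
    ring
  · rw [he]
    positivity

theorem isUnit_and_norm_of_eq_sq {α β : ℝ} (h : α = β ^ 2) (hα : 0 < α) :
    IsUnit (shiftedVolterra ((α : ℂ) + (β : ℂ) * Complex.I)) ∧
      ‖volterraResolvent ((α : ℂ) + (β : ℂ) * Complex.I)‖ = 1 / α := by
  have hp : IsExtremalProfile α α 0 (fun x => x) (fun _ => 1) :=
    ⟨fun x => hasDerivAt_id x, fun x => by simpa using hasDerivAt_const x (1 : ℝ), rfl,
      fun x hx => hx.1, rfl⟩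
  have he : α ^ 2 + β ^ 2 - α = α ^ 2 := by rw [← h]; ring
  have := hp.isUnit_and_norm (β := β) hα (by rw [← h]; ring) (by rw [he]; positivity)
  rwa [he, Real.sqrt_sq hα.le] at this

theorem isUnit_and_norm_of_neg {α : ℝ} (hα : α < 0) :
    IsUnit (shiftedVolterra (α : ℂ)) ∧ ‖volterraResolvent (α : ℂ)‖ = 1 / |α| := by
  have hl : 0 < α ^ 2 := sq_pos_of_neg hα
  have hb : ∀ f : L2unit, α ^ 2 * ‖f‖ ^ 2 ≤ ‖shiftedVolterra (α : ℂ) f‖ ^ 2 := by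
    -- With `l = α²` and `k = -α`, the two sides of the pointwise inequality differ by `|z|²`; `k`
    -- is positive, so no limit in `δ` is needed.
    refine bound_of_approximate_multipliers fun δ hδ =>
      ⟨fun _ => -α, fun _ => 0, fun x _ => hasDerivAt_const x _, fun x _ z y => ?_, by linarith⟩
    simp only [Complex.normSq_apply, Complex.sub_re, Complex.sub_im, Complex.mul_re,
      Complex.mul_im, Complex.ofReal_re, Complex.ofReal_im]
    nlinarith [sq_nonneg z.re, sq_nonneg z.im]
  have hu := isUnit_shiftedVolterra_of_bound (Complex.ofReal_ne_zero.2 hα.ne) hl hb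
  refine ⟨hu, le_antisymm ?_ ?_⟩
  · simpa [Real.sqrt_sq_eq_abs] using norm_volterraResolvent_le hl hu hb
  · simpa using inv_norm_le_norm_volterraResolvent hu

/-! ### Existence of the roots -/

theorem exists_isCothRoot {α β : ℝ} (h : β ^ 2 < α) : ∃ γ, IsCothRoot α β γ := by
  have hα : 0 < α := (sq_nonneg β).trans_lt h
  set s : ℝ → ℝ := fun γ => γ / (β ^ 2 + γ ^ 2)
  set G : ℝ → ℝ := fun γ => α * Real.sinh (s γ) - γ * Real.cosh (s γ)
  -- The left endpoint must avoid `0`: there `G` is `0`, and for `β = 0` the quotient `s` blows up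
  -- nearby. The condition on `e` is `e (1 + s e) < α * s e`, rewritten with `e = s e * (β² + e²)`.
  obtain ⟨e, he0, he1⟩ : ∃ e : ℝ, 0 < e ∧ β ^ 2 + e ^ 2 + e < α := by
    have hc : ContinuousAt (fun e : ℝ => β ^ 2 + e ^ 2 + e) 0 := by fun_prop
    have hev : ∀ᶠ e in nhdsWithin (0 : ℝ) (Ioi 0), β ^ 2 + e ^ 2 + e < α :=
      (hc.eventually (gt_mem_nhds (by simpa using h))).filter_mono nhdsWithin_le_nhds
    obtain ⟨e, h1, h2⟩ := (hev.and self_mem_nhdsWithin).exists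
    exact ⟨e, h2, h1⟩
  have heα : e < α := by nlinarith
  have hcont : ContinuousOn G (Icc e α) := by
    have hs : ContinuousOn s (Icc e α) := by
      refine continuousOn_id.div (by fun_prop) fun x hx => ?_
      have : 0 < x := he0.trans_le hx.1
      positivity
    exact (continuousOn_const.mul (Real.continuous_sinh.comp_continuousOn hs)).sub
      (continuousOn_id.mul (Real.continuous_cosh.comp_continuousOn hs))
  have hGα : G α < 0 := by
    have : Real.sinh (s α) < Real.cosh (s α) := Real.sinh_lt_cosh _
    simp only [G]
    nlinarith
  have hGe : 0 < G e := by
    have hde : 0 < β ^ 2 + e ^ 2 := by positivity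
    have hspos : 0 < s e := div_pos he0 hde
    have h1 : s e < Real.sinh (s e) := Real.self_lt_sinh_iff.2 hspos
    have h2 : Real.cosh (s e) - Real.sinh (s e) ≤ 1 := by
      rw [Real.cosh_sub_sinh]
      exact Real.exp_le_one_iff.2 (by linarith)
    have h3 : e * (1 + s e) < α * s e := by
      have h4 : e = s e * (β ^ 2 + e ^ 2) := by simp only [s]; field_simp
      nlinarith
    have h5 : s e * Real.cosh (s e) ≤ (1 + s e) * Real.sinh (s e) := by nlinarith
    have h6 : 0 < s e * G e := by
      have h7 : e * (s e * Real.cosh (s e)) ≤ e * ((1 + s e) * Real.sinh (s e)) :=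
        mul_le_mul_of_nonneg_left h5 he0.le
      have h8 : e * (1 + s e) * Real.sinh (s e) < α * s e * Real.sinh (s e) :=
        mul_lt_mul_of_pos_right h3 (hspos.trans h1)
      simp only [G]
      linarith
    exact (pos_iff_pos_of_mul_pos h6).1 hspos
  obtain ⟨γ, hγ, hG⟩ := intermediate_value_Ioo' heα.le hcont ⟨hGα, hGe⟩
  have hγ0 : 0 < γ := he0.trans hγ.1
  refine ⟨γ, ⟨hγ0, hγ.2⟩, ?_⟩
  have hs : 0 < Real.sinh (γ / (β ^ 2 + γ ^ 2)) := Real.sinh_pos_iff.2 (by positivity)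
  rw [realCoth, div_eq_div_iff hs.ne' hγ0.ne']
  simp only [G, s] at hG
  linarith

theorem exists_isCotRoot {α β : ℝ} (h : α < β ^ 2) (hβ : β ≠ 0) : ∃ γ, IsCotRoot α β γ := by
  have hb : 0 < β ^ 2 := by positivity
  have hpi := Real.pi_pos
  -- the endpoint `a` where `γ / (β² - γ²)` reaches `π`
  obtain ⟨a, ha, haeq⟩ : ∃ a ∈ Ioo (0 : ℝ) |β|, Real.pi * (β ^ 2 - a ^ 2) - a = 0 := by
    have hc : ContinuousOn (fun a : ℝ => Real.pi * (β ^ 2 - a ^ 2) - a) (Icc 0 |β|) := by fun_prop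
    refine intermediate_value_Ioo' (abs_nonneg β) hc ⟨?_, ?_⟩
    · simpa using hβ
    · simpa using mul_pos hpi hb
  have hden : ∀ x ∈ Icc 0 a, 0 < β ^ 2 - x ^ 2 := fun x hx => by
    rw [sub_pos, sq_lt_sq, abs_of_nonneg hx.1]
    exact hx.2.trans_lt ha.2
  set s : ℝ → ℝ := fun γ => γ / (β ^ 2 - γ ^ 2)
  -- This is `cos s - (α/γ) sin s`, written with `sinc` so that it extends continuously to `γ = 0`,
  -- where it equals `1 - α/β² > 0`.
  set G : ℝ → ℝ := fun γ => Real.cos (s γ) - α / (β ^ 2 - γ ^ 2) * Real.sinc (s γ)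
  have hcont : ContinuousOn G (Icc 0 a) := by
    have hs : ContinuousOn s (Icc 0 a) :=
      continuousOn_id.div (by fun_prop) fun x hx => (hden x hx).ne'
    exact (Real.continuous_cos.comp_continuousOn hs).sub
      ((continuousOn_const.div (by fun_prop) fun x hx => (hden x hx).ne').mul
        (Real.continuous_sinc.comp_continuousOn hs))
  have hda := hden a (right_mem_Icc.2 ha.1.le)
  have hsa : s a = Real.pi := by
    simp only [s]
    rw [div_eq_iff hda.ne']
    linarith
  have hGa : G a < 0 := by
    simp only [G]
    rw [hsa, Real.sinc_of_ne_zero hpi.ne']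
    simp
  have hG0 : 0 < G 0 := by
    simp [G, s, div_lt_one hb, h]
  obtain ⟨γ, hγ, hG⟩ := intermediate_value_Ioo' ha.1.le hcont ⟨hGa, hG0⟩
  have hdγ := hden γ (Ioo_subset_Icc_self hγ)
  have hs0 : 0 < s γ := div_pos hγ.1 hdγ
  have hsπ : s γ < Real.pi := by
    simp only [s]
    rw [div_lt_iff₀ hdγ]
    have hsq : γ ^ 2 < a ^ 2 := pow_lt_pow_left₀ hγ.2 hγ.1.le two_ne_zero
    linarith [mul_lt_mul_of_pos_left hsq hpi, hγ.2]
  refine ⟨γ, hγ.1, ⟨hs0, hsπ⟩, ?_⟩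
  have hsin := Real.sin_pos_of_pos_of_lt_pi hs0 hsπ
  change Real.cot (s γ) = _
  rw [Real.cot_eq_cos_div_sin, div_eq_div_iff hsin.ne' hγ.1.ne']
  simp only [G] at hG
  rw [Real.sinc_of_ne_zero hs0.ne', sub_eq_zero] at hG
  rw [hG]
  have : γ = s γ * (β ^ 2 - γ ^ 2) := by simp only [s]; field_simp
  calc α / (β ^ 2 - γ ^ 2) * (Real.sin (s γ) / s γ) * γ
      = α / (β ^ 2 - γ ^ 2) * (Real.sin (s γ) / s γ) * (s γ * (β ^ 2 - γ ^ 2)) := by rw [← this]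
    _ = α * Real.sin (s γ) := by field_simp

/-! ### Uniqueness of the roots and assembly -/

theorem eq_of_one_div_sqrt_eq {x y : ℝ} (hx : 0 < x) (hy : 0 < y) (h : 1 / √x = 1 / √y) :
    x = y := by
  rw [one_div, one_div, inv_inj] at h
  exact (Real.sqrt_inj hx.le hy.le).1 h

/-- No monotonicity is needed: every root computes the same operator norm, and that norm determines
`γ > 0`. -/
theorem IsCothRoot.unique {α β γ δ : ℝ} (h : IsCothRoot α β γ) (h' : IsCothRoot α β δ) :
    γ = δ := by
  have he := h.isUnit_and_norm.2.symm.trans h'.isUnit_and_norm.2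
  obtain ⟨⟨h0, h1⟩, -⟩ := h
  obtain ⟨⟨h0', h1'⟩, -⟩ := h'
  have := eq_of_one_div_sqrt_eq (by nlinarith) (by nlinarith) he
  exact (sq_eq_sq₀ h0.le h0'.le).1 (by linarith)

theorem IsCotRoot.unique {α β γ δ : ℝ} (h : IsCotRoot α β γ) (h' : IsCotRoot α β δ) :
    γ = δ := by
  have he := h.isUnit_and_norm.2.symm.trans h'.isUnit_and_norm.2
  have h0 := h.1
  have h0' := h'.1
  have := eq_of_one_div_sqrt_eq (by positivity) (by positivity) he
  exact (sq_eq_sq₀ h0.le h0'.le).1 (by linarith)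

theorem isUnit_shiftedVolterra {α β : ℝ} (hμ : (α : ℂ) + (β : ℂ) * Complex.I ≠ 0) :
    IsUnit (shiftedVolterra ((α : ℂ) + (β : ℂ) * Complex.I)) := by
  rcases lt_trichotomy α (β ^ 2) with h | h | h
  · by_cases hβ : β = 0
    · subst hβ
      simpa using (isUnit_and_norm_of_neg (by simpa using h)).1
    · exact (exists_isCotRoot h hβ).choose_spec.isUnit_and_norm.1
  · refine (isUnit_and_norm_of_eq_sq h (lt_of_le_of_ne (h ▸ sq_nonneg β) fun h0 => hμ ?_)).1
    have hβ : β = 0 := by rw [← h0] at h; exact pow_eq_zero_iff two_ne_zero |>.1 h.symm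
    simp [← h0, hβ]
  · exact (exists_isCothRoot h).choose_spec.isUnit_and_norm.1

theorem theorem1 (μ : ℂ) (α β : ℝ) (hαβ : μ = (α : ℂ) + (β : ℂ) * Complex.I) (hμ : μ ≠ 0) :
    IsUnit (volterra - μ • (1 : L2unit →L[ℂ] L2unit)) ∧
    (β ^ 2 < α →
      (∃! γ : ℝ, IsCothRoot α β γ) ∧
      ∀ γ : ℝ, IsCothRoot α β γ →
        ‖volterraResolvent μ‖ = 1 / Real.sqrt (α ^ 2 - γ ^ 2)) ∧
    (α = β ^ 2 → ‖volterraResolvent μ‖ = 1 / α) ∧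
    (α < β ^ 2 → β ≠ 0 →
      (∃! γ : ℝ, IsCotRoot α β γ) ∧
      ∀ γ : ℝ, IsCotRoot α β γ →
        ‖volterraResolvent μ‖ = 1 / Real.sqrt (α ^ 2 + γ ^ 2)) ∧
    (α < 0 → β = 0 → ‖volterraResolvent μ‖ = 1 / |α|) := by
  subst hαβ
  refine ⟨isUnit_shiftedVolterra hμ, fun h => ⟨?_, fun γ hγ => hγ.isUnit_and_norm.2⟩, fun h => ?_,
    fun h hβ => ⟨?_, fun γ hγ => hγ.isUnit_and_norm.2⟩, fun hα hβ => ?_⟩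
  · obtain ⟨γ, hγ⟩ := exists_isCothRoot h
    exact ⟨γ, hγ, fun δ hδ => hδ.unique hγ⟩
  · refine (isUnit_and_norm_of_eq_sq h (lt_of_le_of_ne (h ▸ sq_nonneg β) fun h0 => hμ ?_)).2
    have hβ : β = 0 := by rw [← h0] at h; exact pow_eq_zero_iff two_ne_zero |>.1 h.symm
    simp [← h0, hβ]
  · obtain ⟨γ, hγ⟩ := exists_isCotRoot h hβ
    exact ⟨γ, hγ, fun δ hδ => hδ.unique hγ⟩
  · subst hβ
    simpa using (isUnit_and_norm_of_neg hα).2
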